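/- Let $1<p<\infty$. There are constants $c,C>0$, depending only on $p$, such that the following holds for every $n\ge 1$, every open set $\Omega\subset\mathbb R^n$ of Lebesgue measure $|\Omega|=1$, every measurable $f:\Omega\to\mathbb R$ belonging to $L^{p,\infty}(\Omega)+L^p(\Omega)$, and every $t>0$. Let $f_*(s)=\inf\{\lambda\ge 0:|\{x\in\Omega:|f(x)|>\lambda\}|\le s\}$ be the decreasing rearrangement of $|f|$; let $\|g\|_{L^{p,\infty}}=\sup_{s>0}s^{1/p}g_*(s)$ and $$K(f,t;L^{p,\infty},L^p)=\inf\{\|g\|_{L^{p,\infty}}+t\|h\|_{L^p}: f=g+h\ \text{a.e.},\ g\in L^{p,\infty}(\Omega),\ h\in L^p(\Omega)\}.$$ Let $d\nu=dx/x$ on $[0,1]$, $|E|_\nu=\int_E dx/x$, and $$K_p(f,t)=t\,\sup\Big\{\Big(\int_E f_*(\sigma)^p\,d\sigma\Big)^{1/p}:\ E\subset[0,1]\ \text{measurable},\ |E|_\nu=t^{-p}\Big\}.$$ Then $$c\,K_p(f,t)\le K(f,t;L^{p,\infty},L^p)\le C\,K_p(f,t)$$ and $$K_p(f,t)=t\Big(\int_0^{t^{-p}}\psi_{*,\nu}(x)^p\,dx\Big)^{1/p},$$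 where $\psi(s)=s^{1/p}f_*(s)$ for $s\in[0,1]$ and $\psi_{*,\nu}(x)=\inf\{\lambda\ge 0:|\{s\in[0,1]:\psi(s)>\lambda\}|_\nu\le x\}$ is its decreasing rearrangement with respect to $\nu$. -/

import Mathlib

open MeasureTheory Set
open scoped ENNReal NNReal

noncomputable section

/-- The decreasing rearrangement of a nonnegative function `g` with respect to the measure `μ`:
`g_{*,μ}(s) = inf {l : μ {g > l} ≤ s}`, the infimum being `∞` if no finite `l` is admissible. -/
def decRearr {α : Type*} [MeasurableSpace α] (μ : Measure α) (g : α → ℝ≥0∞) (s : ℝ) : ℝ≥0∞ :=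
  sInf {l : ℝ≥0∞ | μ {x | l < g x} ≤ ENNReal.ofReal s}

/-- `f_*`, the decreasing rearrangement of `|f|`. -/
def rearr {α : Type*} [MeasurableSpace α] {μ : Measure α} (f : α →ₘ[μ] ℝ) (s : ℝ) : ℝ≥0∞ :=
  decRearr μ (fun x => ‖f x‖ₑ) s

/-- The (quasi-)norm `sup_{s > 0} s^{1/p} f_*(s)` of the weak Lebesgue space `L^{p,∞}`;
it is `∞` exactly when `f` is not in `L^{p,∞}`. -/
def weakLpENorm {α : Type*} [MeasurableSpace α] {μ : Measure α} (p : ℝ) (f : α →ₘ[μ] ℝ) :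
    ℝ≥0∞ :=
  ⨆ s ∈ Ioi (0 : ℝ), ENNReal.ofReal (s ^ (1 / p)) * rearr f s

/-- The norm of `L^p`; it is `∞` exactly when `f` is not in `L^p`. -/
def strongLpENorm {α : Type*} [MeasurableSpace α] {μ : Measure α} (p : ℝ) (f : α →ₘ[μ] ℝ) :
    ℝ≥0∞ :=
  eLpNorm f (ENNReal.ofReal p) μ

/-- Peetre's `K`-functional of the couple `X₀ = {N₀ < ∞}`, `X₁ = {N₁ < ∞}` of subspaces of `X`,
`K(f,t) = inf {N₀ f₀ + t N₁ f₁ : f = f₀ + f₁, f₀ ∈ X₀, f₁ ∈ X₁}`. -/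
def KFunctional {X : Type*} [AddCommGroup X] (N₀ N₁ : X → ℝ≥0∞) (f : X) (t : ℝ) : ℝ≥0∞ :=
  ⨅ (f₀ : X) (f₁ : X) (_ : f = f₀ + f₁ ∧ N₀ f₀ < ∞ ∧ N₁ f₁ < ∞),
    N₀ f₀ + ENNReal.ofReal t * N₁ f₁

/-- The measure `dν = dx / x` on `[0,1]`. -/
def nu : Measure ℝ :=
  (volume.restrict (Icc (0 : ℝ) 1)).withDensity fun x => ENNReal.ofReal x⁻¹

/-- `K_p(f,t) = t sup {(∫_E f_*^p)^{1/p} : E ⊆ [0,1] measurable, |E|_ν = t^{-p}}`. -/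
def Kp {α : Type*} [MeasurableSpace α] {μ : Measure α} (p : ℝ) (f : α →ₘ[μ] ℝ) (t : ℝ) : ℝ≥0∞ :=
  ENNReal.ofReal t *
    ⨆ (E : Set ℝ) (_ : MeasurableSet E ∧ E ⊆ Icc 0 1 ∧ nu E = ENNReal.ofReal (t ^ (-p))),
      (∫⁻ x in E, rearr f x ^ p) ^ (1 / p)

/-- `ψ(s) = s^{1/p} f_*(s)`. -/
def psi {α : Type*} [MeasurableSpace α] {μ : Measure α} (p : ℝ) (f : α →ₘ[μ] ℝ) (s : ℝ) : ℝ≥0∞ :=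
  ENNReal.ofReal (s ^ (1 / p)) * rearr f s

end

/-! Write `a = t ^ (-p)` and `ψ = psi p f`. Since `∫_E f_* ^ p ds = ∫_E ψ ^ p dν` for `E ⊆ [0,1]`,
the formula for `Kp` says that the integral of `ψ ^ p` over sets of `ν`-measure `a` has supremum the
integral of the rearrangement of `ψ` over `(0, a)`. The measure `ν` is atomless and infinite, so there
is a set of measure exactly `a` between `{ψ > L}` and `{ψ > θ L}`, where `L` is the value of the
rearrangement at `a` and `θ < 1`; it is optimal up to the factor `θ ^ p`
(`lintegral_decRearr_le_of_forall`). Integrals are compared throughout through distribution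
functions (`lintegral_rpow_le_of_measure_lt_le`).

For the lower bound on the `K`-functional, `f = g + h` gives `f_*(s) ≤ g_*(s/2) + h_*(s/2)`. By
Minkowski's inequality on `E`, the first term contributes at most `2 t⁻¹ ‖g‖_{p,∞}`, because
`g_*(s/2) ^ p` is at most a multiple of `‖g‖_{p,∞} ^ p / s` and `|E|_ν = t ^ (-p)`, and the second
contributes at most `2 ‖h‖_p` (`Kp_add_le`).

For the upper bound, one wants to put the part of `f` sitting over `A = {ψ > L}` into `L^p` and the
rest into `L^{p,∞}`. This needs a rank function `r` on `Ω` with `|f| = f_* ∘ r`, and ties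
in `|f|` stand in the way. Since only constants matter, `|f|` is replaced by a function `u` with
`|f| ≤ u ≤ 8 |f|` whose positive level sets are null: round `|f|` to a power of `e` and let a
coordinate of `x` break the ties (`exists_majorant_null_level`). The rank `μ {u > u x}` then inverts
the rearrangement of `u` (`measure_decRearr_lt`), which has the law of `u` (`map_decRearr`). Cutting
`f` according to whether the rank lies in `A` gives `‖g‖_{p,∞} ≤ 8 L` and
`‖h‖_p ^ p ≤ 8 ^ p ∫_A f_* ^ p` (`exists_decomposition`), and both are controlled by `Kp`
(`KFunctional_le`). -/

/-! ### Distribution functions and rearrangements -/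

section Rearrangement

variable {α β : Type*} [MeasurableSpace α] [MeasurableSpace β] {μ : Measure α} {ν : Measure β}

/-- The rearrangement is the generalized inverse of the distribution function. -/
lemma lt_decRearr_iff (g : α → ℝ≥0∞) (s : ℝ) (l : ℝ≥0∞) :
    l < decRearr μ g s ↔ ENNReal.ofReal s < μ {x | l < g x} := by
  constructor
  · intro h
    by_contra! hc
    exact absurd (sInf_le (show l ∈ {l | μ {x | l < g x} ≤ ENNReal.ofReal s} from hc)) h.not_ge
  · intro h
    by_contra! hc
    have hl : l < ⊤ := by
      rw [lt_top_iff_ne_top]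
      rintro rfl
      simp at h
    obtain ⟨w, hw, hwl, hwt⟩ := exists_seq_strictAnti_tendsto' hl
    have hU : {x | l < g x} = ⋃ n, {x | w n < g x} := by
      ext x
      simp only [mem_ofPred_eq, mem_iUnion]
      refine ⟨fun hx => ?_, fun ⟨n, hn⟩ => (hwl n).1.trans hn⟩
      exact (hwt.eventually (gt_mem_nhds hx)).exists
    have hmono : Monotone fun n => {x | w n < g x} :=
      fun m n hmn x hx => (hw.antitone hmn).trans_lt hx
    rw [hU, hmono.measure_iUnion, lt_iSup_iff] at h
    obtain ⟨n, hn⟩ := h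
    obtain ⟨l', hl', hlt⟩ := sInf_lt_iff.1 (hc.trans_lt (hwl n).1)
    refine absurd (hn.trans_le (measure_mono fun x hx => hlt.trans hx)) (not_lt.2 hl')

lemma decRearr_antitone (g : α → ℝ≥0∞) : Antitone (decRearr μ g) := fun s t hst => by
  by_contra! h
  have h1 := (lt_decRearr_iff g t _).1 h
  exact lt_irrefl _ ((lt_decRearr_iff g s _).2 ((ENNReal.ofReal_le_ofReal hst).trans_lt h1))

lemma measurable_decRearr (g : α → ℝ≥0∞) : Measurable (decRearr μ g) :=
  (decRearr_antitone g).measurable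

lemma decRearr_congr_ae {g h : α → ℝ≥0∞} (hgh : g =ᵐ[μ] h) (s : ℝ) :
    decRearr μ g s = decRearr μ h s := by
  refine eq_of_forall_lt_iff fun l => ?_
  rw [lt_decRearr_iff, lt_decRearr_iff, measure_congr (s := {x | l < g x}) (t := {x | l < h x})]
  filter_upwards [hgh] with x hx
  exact congrArg (l < ·) hx

/-- Larger distribution functions have larger integrals. -/
lemma lintegral_le_of_measure_lt_le {g : α → ℝ≥0∞} {h : β → ℝ≥0∞} (hg : Measurable g)
    (hh : Measurable h) (H : ∀ l, μ {x | l < g x} ≤ ν {y | l < h y}) :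
    ∫⁻ x, g x ∂μ ≤ ∫⁻ y, h y ∂ν := by
  -- The layer cake formula is for real functions, so it is applied to the truncations `min g k`.
  have trunc : ∀ (k : ℕ) (x : ℝ≥0∞), ENNReal.ofReal (min x k).toReal = min x k := fun k x =>
    ENNReal.ofReal_toReal (ne_top_of_le_ne_top (ENNReal.natCast_ne_top k) (min_le_right _ _))
  have key : ∀ k : ℕ, ∫⁻ x, min (g x) k ∂μ ≤ ∫⁻ y, min (h y) k ∂ν := by
    intro k
    have e1 := lintegral_eq_lintegral_meas_lt μ (f := fun x => (min (g x) k).toReal)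
      (Filter.Eventually.of_forall fun _ => ENNReal.toReal_nonneg)
      (hg.min measurable_const).ennreal_toReal.aemeasurable
    have e2 := lintegral_eq_lintegral_meas_lt ν (f := fun x => (min (h x) k).toReal)
      (Filter.Eventually.of_forall fun _ => ENNReal.toReal_nonneg)
      (hh.min measurable_const).ennreal_toReal.aemeasurable
    simp only [trunc] at e1 e2
    rw [e1, e2]
    refine setLIntegral_mono' measurableSet_Ioi fun t ht => ?_
    have e : ∀ x : ℝ≥0∞, t < (min x k).toReal ↔ ENNReal.ofReal t < x ∧ ENNReal.ofReal t < k := by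
      intro x
      rw [← ENNReal.ofReal_lt_iff_lt_toReal (le_of_lt ht)
        (ne_top_of_le_ne_top (ENNReal.natCast_ne_top k) (min_le_right _ _)), lt_min_iff]
    simp only [e]
    by_cases hk : ENNReal.ofReal t < k
    · simpa [hk] using H (ENNReal.ofReal t)
    · simp [hk]
  have sup : ∀ x : ℝ≥0∞, x = ⨆ k : ℕ, min x k := fun x => by
    rw [← inf_iSup_eq, ENNReal.iSup_natCast, inf_top_eq]
  have mono : ∀ x : ℝ≥0∞, Monotone fun k : ℕ => min x (k : ℝ≥0∞) := fun x m n hmn =>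
    min_le_min_left _ (Nat.cast_le.2 hmn)
  calc ∫⁻ x, g x ∂μ = ∫⁻ x, ⨆ k : ℕ, min (g x) k ∂μ := by simp_rw [← sup]
    _ = ⨆ k : ℕ, ∫⁻ x, min (g x) k ∂μ :=
      lintegral_iSup (fun k => hg.min measurable_const) fun m n hmn x => mono _ hmn
    _ ≤ ∫⁻ y, h y ∂ν := iSup_le fun k =>
      (key k).trans (lintegral_mono fun y => min_le_left _ _)

lemma lintegral_rpow_le_of_measure_lt_le {g : α → ℝ≥0∞} {h : β → ℝ≥0∞} (hg : Measurable g)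
    (hh : Measurable h) {p : ℝ} (hp : 0 < p) (H : ∀ l, μ {x | l < g x} ≤ ν {y | l < h y}) :
    ∫⁻ x, g x ^ p ∂μ ≤ ∫⁻ y, h y ^ p ∂ν := by
  refine lintegral_le_of_measure_lt_le (hg.pow_const p) (hh.pow_const p) fun l => ?_
  simp only [← ENNReal.rpow_inv_lt_iff hp]
  exact H _

lemma volume_ofReal_lt (c : ℝ) (m : ℝ≥0∞) :
    volume {s : ℝ | s ∈ Ioo 0 c ∧ ENNReal.ofReal s < m} = min (ENNReal.ofReal c) m := by
  by_cases hm : m = ⊤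
  · subst hm
    simp [Ioo]
    simpa [Ioo] using Real.volume_Ioo (a := 0) (b := c)
  · have : {s : ℝ | s ∈ Ioo 0 c ∧ ENNReal.ofReal s < m} = Ioo 0 (min c m.toReal) := by
      ext s
      simp only [mem_ofPred_eq, mem_Ioo, lt_min_iff]
      constructor
      · rintro ⟨⟨h1, h2⟩, h3⟩
        exact ⟨h1, h2, (ENNReal.ofReal_lt_iff_lt_toReal h1.le hm).1 h3⟩
      · rintro ⟨h1, h2, h3⟩
        exact ⟨⟨h1, h2⟩, (ENNReal.ofReal_lt_iff_lt_toReal h1.le hm).2 h3⟩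
    rw [this, Real.volume_Ioo, sub_zero, ENNReal.ofReal_min, ENNReal.ofReal_toReal hm]

/-- On `(0, c)` the rearrangement has the distribution function of `g`, cut off at `c`. -/
lemma volume_lt_decRearr (g : α → ℝ≥0∞) (c : ℝ) (l : ℝ≥0∞) :
    volume.restrict (Ioo 0 c) {s | l < decRearr μ g s} =
      min (ENNReal.ofReal c) (μ {x | l < g x}) := by
  rw [Measure.restrict_apply (measurableSet_lt measurable_const (measurable_decRearr g)),
    ← volume_ofReal_lt]
  congr 1
  ext s
  simp only [mem_inter_iff, mem_ofPred_eq, lt_decRearr_iff, and_comm]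

/-- If every positive level set of `u` is null, then superlevel sets of `u` realize every
measure below that of `{u > 0}`. -/
lemma measure_decRearr_lt [IsFiniteMeasure μ] {u : α → ℝ≥0∞} (hu : Measurable u)
    (hnull : ∀ l, l ≠ 0 → μ {x | u x = l} = 0) {s : ℝ} (hs : ENNReal.ofReal s < μ {x | 0 < u x}) :
    μ {x | decRearr μ u s < u x} = ENNReal.ofReal s := by
  have hpos : 0 < decRearr μ u s := (lt_decRearr_iff u s 0).2 hs
  set U := decRearr μ u s with hU
  refine le_antisymm (not_lt.1 fun h => lt_irrefl _ ((lt_decRearr_iff u s U).2 h)) ?_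
  obtain ⟨w, hw, hwl, hwt⟩ := exists_seq_strictMono_tendsto' hpos
  have h1 : {x | U ≤ u x} = ⋂ n, {x | w n < u x} := by
    ext x
    simp only [mem_ofPred_eq, mem_iInter]
    refine ⟨fun hx n => (hwl n).2.trans_le hx, fun h => ?_⟩
    exact le_of_tendsto' hwt fun n => (h n).le
  have h2 : ENNReal.ofReal s ≤ μ {x | U ≤ u x} := by
    have hanti : Antitone fun n => {x | w n < u x} :=
      fun m n hmn x hx => (hw.monotone hmn).trans_lt hx
    rw [h1, hanti.measure_iInter
      (fun n => (measurableSet_lt measurable_const hu).nullMeasurableSet) ⟨0, measure_ne_top _ _⟩]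
    exact le_iInf fun n => ((lt_decRearr_iff u s _).1 (hwl n).2).le
  have h3 : {x | U ≤ u x} ⊆ {x | U < u x} ∪ {x | u x = U} := fun x hx =>
    (lt_or_eq_of_le (show U ≤ u x from hx)).imp id Eq.symm
  calc ENNReal.ofReal s ≤ μ {x | U ≤ u x} := h2
    _ ≤ μ {x | U < u x} + μ {x | u x = U} := (measure_mono h3).trans (measure_union_le _ _)
    _ = μ {x | U < u x} := by rw [hnull U hpos.ne', add_zero]

end Rearrangement

/-! ### The measure `dx / x` and suprema over sets of prescribed measure -/

section Nu

lemma measurable_inv_ofReal : Measurable fun x : ℝ => ENNReal.ofReal x⁻¹ := by fun_prop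

instance : SigmaFinite nu := by
  unfold nu
  infer_instance

instance : NullSingletonClass nu := by
  unfold nu
  infer_instance

lemma nu_inter_Icc {s : Set ℝ} (hs : MeasurableSet s) : nu (s ∩ Icc 0 1) = nu s := by
  unfold nu
  rw [withDensity_apply _ hs, withDensity_apply _ (hs.inter measurableSet_Icc),
    Measure.restrict_restrict hs, Measure.restrict_restrict (hs.inter measurableSet_Icc),
    inter_assoc, inter_self]

lemma nu_Icc : nu (Icc 0 1) = ⊤ := by
  -- Otherwise `x⁻¹` would be integrable near `0`.
  by_contra h
  unfold nu at h
  rw [withDensity_apply _ measurableSet_Icc, Measure.restrict_restrict measurableSet_Icc,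
    inter_self] at h
  have hi : IntegrableOn (fun x : ℝ => x⁻¹) (Icc 0 1) := by
    refine ⟨by fun_prop, ?_⟩
    rw [hasFiniteIntegral_iff_enorm, setLIntegral_congr_fun measurableSet_Icc
      (g := fun x : ℝ => ENNReal.ofReal x⁻¹)
      fun x hx => Real.enorm_of_nonneg (inv_nonneg.2 hx.1)]
    exact lt_top_iff_ne_top.2 h
  have := (intervalIntegrable_iff_integrableOn_Icc_of_le zero_le_one).2 hi
  simp at this

/-- Since `(x ^ (1 / p)) ^ p dν = dx` on `[0,1]`, the factor `x ^ (1 / p)` turns `dx` into `dν`.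
The junk value of the density at `0` does not matter, as `{0}` is null. -/
lemma setLIntegral_eq_setLIntegral_nu {F : ℝ → ℝ≥0∞} (hF : Measurable F) {p : ℝ} (hp : 0 < p)
    {E : Set ℝ} (hE : MeasurableSet E) (hE1 : E ⊆ Icc 0 1) :
    ∫⁻ x in E, F x ^ p = ∫⁻ x in E, (ENNReal.ofReal (x ^ (1 / p)) * F x) ^ p ∂nu := by
  unfold nu
  rw [restrict_withDensity hE, Measure.restrict_restrict_of_subset hE1,
    lintegral_withDensity_eq_lintegral_mul _ measurable_inv_ofReal (by fun_prop)]
  have h0 : ∀ᵐ x ∂volume.restrict E, x ≠ (0 : ℝ) := by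
    rw [ae_iff]
    simp
  refine lintegral_congr_ae ?_
  filter_upwards [h0, ae_restrict_mem hE] with x hx hxE
  have hx0 : 0 < x := lt_of_le_of_ne (hE1 hxE).1 hx.symm
  simp only [Pi.mul_apply]
  rw [ENNReal.mul_rpow_of_nonneg _ _ hp.le,
    ENNReal.ofReal_rpow_of_pos (Real.rpow_pos_of_pos hx0 _), ← Real.rpow_mul hx0.le,
    one_div_mul_cancel hp.ne', Real.rpow_one, ← mul_assoc, ← ENNReal.ofReal_mul (by positivity),
    inv_mul_cancel₀ hx, ENNReal.ofReal_one, one_mul]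

/-- `nu` takes every value between those at two nested sets. The set added to the smaller one is a
superlevel set of the identity, which has null level sets. -/
lemma exists_nu_eq {B D : Set ℝ} (hB : MeasurableSet B) (hD : MeasurableSet D) (hBD : B ⊆ D)
    (hD1 : D ⊆ Icc 0 1) {a : ℝ≥0∞} (hBa : nu B ≤ a) (haD : a < nu D) :
    ∃ E, MeasurableSet E ∧ B ⊆ E ∧ E ⊆ D ∧ nu E = a := by
  obtain ⟨D', hD', hD'D, haD', hD'fin⟩ := Measure.exists_subset_measure_lt_top hD haD
  have hBfin : nu B ≠ ⊤ := (hBa.trans_lt (haD.trans_le le_top)).ne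
  set T := D' \ B with hT
  have hTm : MeasurableSet T := hD'.diff hB
  have hTfin : nu T < ⊤ := (measure_mono sdiff_subset).trans_lt hD'fin
  have : IsFiniteMeasure (nu.restrict T) := ⟨by simpa using hTfin⟩
  have ha : a ≠ ⊤ := (haD.trans_le le_top).ne
  have hlt : a - nu B < nu T := by
    refine ENNReal.sub_lt_of_lt_add hBa ?_
    refine haD'.trans_le ((measure_mono (t := T ∪ B) ?_).trans (measure_union_le _ _))
    rw [hT, sdiff_union_self]
    exact subset_union_left
  have hu : Measurable fun x : ℝ => ENNReal.ofReal x := ENNReal.measurable_ofReal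
  have hpos : nu T ≤ nu.restrict T {x | 0 < ENNReal.ofReal x} := by
    rw [Measure.restrict_apply (measurableSet_lt measurable_const hu)]
    have : T ⊆ ({x | 0 < ENNReal.ofReal x} ∩ T) ∪ {0} := fun x hx => by
      rcases eq_or_lt_of_le (hD1 (hD'D hx.1)).1 with h | h
      · exact Or.inr h.symm
      · exact Or.inl ⟨ENNReal.ofReal_pos.2 h, hx⟩
    refine (measure_mono this).trans ((measure_union_le _ _).trans ?_)
    simp
  have hnull : ∀ l : ℝ≥0∞, l ≠ 0 → nu.restrict T {x | ENNReal.ofReal x = l} = 0 := by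
    intro l hl
    refine measure_mono_null (t := {l.toReal}) (fun x hx => ?_) (by simp)
    have hx' : ENNReal.ofReal x = l := hx
    have hx0 : 0 < x := ENNReal.ofReal_pos.1 (by rw [hx']; exact pos_iff_ne_zero.2 hl)
    rw [mem_singleton_iff, ← hx', ENNReal.toReal_ofReal hx0.le]
  have e : ENNReal.ofReal (a - nu B).toReal = a - nu B :=
    ENNReal.ofReal_toReal (ne_top_of_le_ne_top ha tsub_le_self)
  have key := measure_decRearr_lt hu hnull (s := (a - nu B).toReal)
    (by rw [e]; exact hlt.trans_le hpos)
  set U := decRearr (nu.restrict T) (fun x => ENNReal.ofReal x) (a - nu B).toReal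
  have hS : MeasurableSet {x : ℝ | U < ENNReal.ofReal x} := measurableSet_lt measurable_const hu
  rw [Measure.restrict_apply hS, e] at key
  refine ⟨B ∪ ({x | U < ENNReal.ofReal x} ∩ T), hB.union (hS.inter hTm), subset_union_left,
    union_subset hBD fun x hx => hD'D hx.2.1, ?_⟩
  rw [measure_union (disjoint_left.2 fun x hx h => h.2.2 hx) (hS.inter hTm), key,
    add_tsub_cancel_of_le hBa]

/-- Integrals over sets of `nu`-measure `a` are at most that of the rearrangement over `(0, a)`. -/
lemma setLIntegral_le_lintegral_decRearr {ψ : ℝ → ℝ≥0∞} (hψ : Measurable ψ) {p a : ℝ}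
    (hp : 0 < p) {E : Set ℝ} (hEa : nu E ≤ ENNReal.ofReal a) :
    ∫⁻ x in E, ψ x ^ p ∂nu ≤ ∫⁻ x in Ioo 0 a, decRearr nu ψ x ^ p := by
  refine lintegral_rpow_le_of_measure_lt_le hψ (measurable_decRearr ψ) hp fun l => ?_
  rw [volume_lt_decRearr]
  refine le_min ?_ (Measure.restrict_apply_le _ _)
  exact (measure_mono (subset_univ _)).trans (by simpa using hEa)

/-- The rearrangement integral over `(0, a)` is the least upper bound of the integrals over sets
of `nu`-measure `a`. -/
lemma lintegral_decRearr_le_of_forall {ψ : ℝ → ℝ≥0∞} (hψ : Measurable ψ) {p a : ℝ}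
    (hp : 0 < p) (ha : 0 < a) {M : ℝ≥0∞}
    (hM : ∀ E, MeasurableSet E → E ⊆ Icc 0 1 → nu E = ENNReal.ofReal a →
      ∫⁻ x in E, ψ x ^ p ∂nu ≤ M) :
    ∫⁻ x in Ioo 0 a, decRearr nu ψ x ^ p ≤ M := by
  have ha' : 0 < ENNReal.ofReal a := ENNReal.ofReal_pos.2 ha
  have hmeas : ∀ l : ℝ≥0∞, MeasurableSet {x | l < ψ x} := fun l =>
    measurableSet_lt measurable_const hψ
  set L := decRearr nu ψ a with hL
  have super : ∀ l < L, ENNReal.ofReal a < nu ({x | l < ψ x} ∩ Icc 0 1) := fun l hl => by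
    rw [nu_inter_Icc (hmeas l)]
    exact (lt_decRearr_iff ψ a l).1 hl
  by_cases hLtop : L = ⊤
  · -- Every superlevel set carries a set of measure `a`, so no finite `M` is admissible.
    have bound : ∀ l : ℝ≥0, (l : ℝ≥0∞) ^ p * ENNReal.ofReal a ≤ M := by
      intro l
      obtain ⟨E, hE, -, hED, hEa⟩ := exists_nu_eq MeasurableSet.empty
        ((hmeas l).inter measurableSet_Icc) (empty_subset _) inter_subset_right
        (by simp) (super l (hLtop ▸ ENNReal.coe_lt_top))
      refine le_trans ?_ (hM E hE (hED.trans inter_subset_right) hEa)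
      rw [← hEa, ← setLIntegral_const]
      exact setLIntegral_mono' hE fun x hx => ENNReal.rpow_le_rpow (hED hx).1.le hp.le
    have : (M / ENNReal.ofReal a) ^ p⁻¹ = ⊤ := ENNReal.eq_top_of_forall_nnreal_le fun l => by
      rw [ENNReal.le_rpow_inv_iff hp, ENNReal.le_div_iff_mul_le (Or.inl ha'.ne')
        (Or.inl ENNReal.ofReal_ne_top)]
      exact bound l
    rw [ENNReal.rpow_eq_top_iff_of_pos (inv_pos.2 hp), ENNReal.div_eq_top] at this
    rcases this with h | h
    · exact absurd h.2 ha'.ne'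
    · exact h.1 ▸ le_top
  have main : ∀ θ : ℝ≥0∞, 0 < θ → θ < 1 →
      θ ^ p * ∫⁻ x in Ioo 0 a, decRearr nu ψ x ^ p ≤ M := by
    -- A set `E` of measure `a` between `{L < ψ}` and `{θ L < ψ}` will do: `ψ` on `E` has at least
    -- the distribution function of `θ` times the rearrangement on `(0, a)`.
    intro θ hθ0 hθ1
    have hθtop : θ ≠ ⊤ := (hθ1.trans ENNReal.one_lt_top).ne
    have hBa : nu ({x | L < ψ x} ∩ Icc 0 1) ≤ ENNReal.ofReal a := by
      rw [nu_inter_Icc (hmeas L)]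
      exact not_lt.1 fun h => lt_irrefl _ ((lt_decRearr_iff ψ a L).2 h)
    obtain ⟨E, hE, hE1, hBE, hEa, hEL⟩ : ∃ E, MeasurableSet E ∧ E ⊆ Icc 0 1 ∧
        {x | L < ψ x} ∩ Icc 0 1 ⊆ E ∧ nu E = ENNReal.ofReal a ∧
        (L ≠ 0 → ∀ x ∈ E, θ * L < ψ x) := by
      -- If `L = 0`, nothing lies below `L`, and `E` need only have the right measure.
      by_cases hL0 : L = 0
      · obtain ⟨E, hE, hBE, hED, hEa⟩ := exists_nu_eq ((hmeas L).inter measurableSet_Icc)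
          measurableSet_Icc inter_subset_right subset_rfl hBa
          (by rw [nu_Icc]; exact ENNReal.ofReal_lt_top)
        exact ⟨E, hE, hED, hBE, hEa, fun h => absurd hL0 h⟩
      · have hlt : θ * L < L := by
          simpa using ENNReal.mul_lt_mul_left hL0 hLtop hθ1
        obtain ⟨E, hE, hBE, hED, hEa⟩ := exists_nu_eq ((hmeas L).inter measurableSet_Icc)
          ((hmeas (θ * L)).inter measurableSet_Icc)
          (inter_subset_inter_left _ fun x hx => hlt.trans hx) inter_subset_right hBa
          (super _ hlt)
        exact ⟨E, hE, hED.trans inter_subset_right, hBE, hEa, fun _ x hx => (hED hx).1⟩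
    refine le_trans ?_ (hM E hE hE1 hEa)
    rw [← lintegral_const_mul' _ _ (ENNReal.rpow_ne_top_of_nonneg hp.le hθtop)]
    simp only [← ENNReal.mul_rpow_of_nonneg _ _ hp.le]
    refine lintegral_rpow_le_of_measure_lt_le ((measurable_decRearr ψ).const_mul θ) hψ hp
      fun l => ?_
    have e : ∀ y : ℝ≥0∞, l < θ * y ↔ l / θ < y := fun y => by
      rw [ENNReal.div_lt_iff (Or.inl hθ0.ne') (Or.inl hθtop), mul_comm]
    simp only [e]
    rw [volume_lt_decRearr, Measure.restrict_apply (hmeas l)]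
    by_cases hlL : l / θ < L
    · refine (min_le_left _ _).trans ?_
      rw [← hEa]
      refine measure_mono fun x hx => ⟨?_, hx⟩
      refine lt_trans ?_ (hEL (ne_zero_of_lt hlL) x hx)
      exact (e L).2 hlL
    · refine (min_le_right _ _).trans ?_
      rw [← nu_inter_Icc (hmeas _)]
      refine measure_mono fun x hx => ⟨?_, hBE ⟨(not_lt.1 hlL).trans_lt hx.1, hx.2⟩⟩
      refine lt_of_le_of_lt ?_ (show l / θ < ψ x from hx.1)
      rw [ENNReal.le_div_iff_mul_le (Or.inl hθ0.ne') (Or.inl hθtop)]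
      exact mul_le_of_le_one_right' hθ1.le
  rw [← one_mul (∫⁻ x in Ioo 0 a, decRearr nu ψ x ^ p)]
  refine ENNReal.mul_le_of_forall_lt fun b hb d hd => ?_
  rcases eq_or_ne b 0 with rfl | hb0
  · simp
  have := main (b ^ p⁻¹) (ENNReal.rpow_pos (pos_iff_ne_zero.2 hb0) (hb.trans ENNReal.one_lt_top).ne)
    (ENNReal.rpow_lt_one hb (inv_pos.2 hp))
  rw [ENNReal.rpow_inv_rpow hp.ne'] at this
  exact (mul_le_mul_right hd.le b).trans this

end Nu

/-! ### The functional `Kp` as a rearrangement integral, and the lower bound -/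

section Lower

variable {α : Type*} [MeasurableSpace α] {μ : Measure α} {p : ℝ}

lemma measurable_enorm_coeFn (f : α →ₘ[μ] ℝ) : Measurable fun x => ‖f x‖ₑ :=
  f.measurable.enorm

lemma measurable_rearr (f : α →ₘ[μ] ℝ) : Measurable (rearr f) := measurable_decRearr _

lemma measurable_psi (f : α →ₘ[μ] ℝ) : Measurable (psi p f) :=
  Measurable.mul (by fun_prop) (measurable_rearr f)

lemma setLIntegral_rearr_eq (hp : 0 < p) (f : α →ₘ[μ] ℝ) {E : Set ℝ} (hE : MeasurableSet E)
    (hE1 : E ⊆ Icc 0 1) :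
    ∫⁻ x in E, rearr f x ^ p = ∫⁻ x in E, psi p f x ^ p ∂nu :=
  setLIntegral_eq_setLIntegral_nu (measurable_rearr f) hp hE hE1

theorem Kp_eq (hp : 0 < p) (f : α →ₘ[μ] ℝ) {t : ℝ} (ht : 0 < t) :
    Kp p f t = ENNReal.ofReal t *
      (∫⁻ x in Ioo 0 (t ^ (-p)), decRearr nu (psi p f) x ^ p) ^ (1 / p) := by
  unfold Kp
  congr 1
  refine le_antisymm (iSup₂_le fun E hE => ?_) ?_
  · rw [setLIntegral_rearr_eq hp f hE.1 hE.2.1]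
    exact ENNReal.rpow_le_rpow
      (setLIntegral_le_lintegral_decRearr (measurable_psi f) hp hE.2.2.le) (by positivity)
  · rw [one_div, ENNReal.rpow_inv_le_iff hp]
    refine lintegral_decRearr_le_of_forall (measurable_psi f) hp (Real.rpow_pos_of_pos ht _)
      fun E hE hE1 hEa => ?_
    rw [← setLIntegral_rearr_eq hp f hE hE1, ← ENNReal.rpow_inv_le_iff hp]
    exact le_iSup₂ (f := fun (E : Set ℝ) (_ : MeasurableSet E ∧ E ⊆ Icc 0 1 ∧
      nu E = ENNReal.ofReal (t ^ (-p))) => (∫⁻ x in E, rearr f x ^ p) ^ p⁻¹) E ⟨hE, hE1, hEa⟩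

lemma rearr_add_le (g h : α →ₘ[μ] ℝ) {s : ℝ} (hs : 0 ≤ s) :
    rearr (g + h) s ≤ rearr g (s / 2) + rearr h (s / 2) := by
  by_contra! hc
  have h1 := (lt_decRearr_iff _ _ _).1 hc
  have h2 : ∀ k : α →ₘ[μ] ℝ, μ {x | rearr k (s / 2) < ‖k x‖ₑ} ≤ ENNReal.ofReal (s / 2) := fun k =>
    not_lt.1 fun h => lt_irrefl _ ((lt_decRearr_iff _ _ _).2 h)
  have h3 : μ {x | rearr g (s / 2) + rearr h (s / 2) < ‖(g + h) x‖ₑ} ≤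
      μ ({x | rearr g (s / 2) < ‖g x‖ₑ} ∪ {x | rearr h (s / 2) < ‖h x‖ₑ}) := by
    refine measure_mono_ae ?_
    filter_upwards [AEEqFun.coeFn_add g h] with x hx hlt
    by_contra hn
    have hn' : ‖g x‖ₑ ≤ rearr g (s / 2) ∧ ‖h x‖ₑ ≤ rearr h (s / 2) :=
      ⟨not_lt.1 fun h => hn (Or.inl h), not_lt.1 fun h => hn (Or.inr h)⟩
    have hlt' : rearr g (s / 2) + rearr h (s / 2) < ‖(g + h) x‖ₑ := hlt
    rw [hx] at hlt'
    exact absurd (hlt'.trans_le ((enorm_add_le _ _).trans (add_le_add hn'.1 hn'.2))) (lt_irrefl _)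
  refine absurd (h1.trans_le (h3.trans ((measure_union_le _ _).trans
    (add_le_add (h2 g) (h2 h))))) ?_
  rw [← ENNReal.ofReal_add (by positivity) (by positivity), add_halves]
  exact lt_irrefl _

/-- The dilation `s ↦ s / 2` doubles the distribution function of the rearrangement, so the bound
compares it with `h` under the measure `2 • μ`. -/
lemma lintegral_rearr_half_le (hp : 0 < p) (h : α →ₘ[μ] ℝ) {E : Set ℝ} (hE : MeasurableSet E)
    (hE1 : E ⊆ Icc 0 1) :
    ∫⁻ s in E, rearr h (s / 2) ^ p ≤ 2 * ∫⁻ x, ‖h x‖ₑ ^ p ∂μ := by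
  rw [← smul_eq_mul, ← lintegral_smul_measure]
  refine lintegral_rpow_le_of_measure_lt_le ((measurable_rearr h).comp (measurable_id.div_const 2))
    (measurable_enorm_coeFn h) hp fun l => ?_
  rw [Measure.restrict_apply' hE, Measure.smul_apply, smul_eq_mul]
  set m := μ {x | l < ‖h x‖ₑ} with hm
  by_cases hmt : m = ⊤
  · simp [hmt]
  refine (measure_mono (t := Ico 0 (2 * m.toReal)) fun s hs => ?_).trans_eq ?_
  · have h0 := (hE1 hs.2).1
    have h1 := (lt_decRearr_iff _ _ _).1 hs.1
    have h2 : s / 2 < m.toReal := (ENNReal.ofReal_lt_iff_lt_toReal (by positivity) hmt).1 h1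
    exact ⟨h0, by linarith⟩
  · rw [Real.volume_Ico, sub_zero, ENNReal.ofReal_mul zero_le_two, ENNReal.ofReal_toReal hmt]
    simp

lemma rpow_mul_rearr_half_le (hp : 1 < p) (g : α →ₘ[μ] ℝ) {s : ℝ} (hs : 0 ≤ s) :
    ENNReal.ofReal (s ^ (1 / p)) * rearr g (s / 2) ≤ 2 * weakLpENorm p g := by
  rcases eq_or_lt_of_le hs with rfl | hs
  · rw [Real.zero_rpow (by positivity)]
    simp
  have h1 : ENNReal.ofReal ((s / 2) ^ (1 / p)) * rearr g (s / 2) ≤ weakLpENorm p g :=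
    le_iSup₂ (f := fun (s : ℝ) (_ : s ∈ Ioi (0 : ℝ)) =>
      ENNReal.ofReal (s ^ (1 / p)) * rearr g s) (s / 2) (show (0 : ℝ) < s / 2 by positivity)
  refine le_trans ?_ (mul_le_mul_right h1 2)
  rw [← mul_assoc]
  refine mul_le_mul_left ?_ _
  have h2 : s ^ (1 / p) ≤ 2 * (s / 2) ^ (1 / p) := by
    rw [Real.div_rpow hs.le zero_le_two]
    have h3 : (2 : ℝ) ^ (1 / p) ≤ 2 := by
      simpa using Real.rpow_le_rpow_of_exponent_le one_le_two
        ((div_le_one (zero_lt_one.trans hp)).2 hp.le)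
    have h4 : 0 < (2 : ℝ) ^ (1 / p) := by positivity
    have h5 : 0 ≤ s ^ (1 / p) := by positivity
    rw [← mul_div_assoc, le_div_iff₀ h4, mul_comm]
    exact mul_le_mul_of_nonneg_right h3 h5
  calc ENNReal.ofReal (s ^ (1 / p)) ≤ ENNReal.ofReal (2 * (s / 2) ^ (1 / p)) :=
        ENNReal.ofReal_le_ofReal h2
    _ = _ := by rw [ENNReal.ofReal_mul zero_le_two]; simp

lemma ofReal_rpow_neg_rpow (hp : 0 < p) {t : ℝ} (ht : 0 < t) :
    ENNReal.ofReal (t ^ (-p)) ^ (1 / p) = (ENNReal.ofReal t)⁻¹ := by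
  rw [← ENNReal.ofReal_rpow_of_pos ht, ← ENNReal.rpow_mul, neg_mul, mul_one_div_cancel hp.ne',
    ENNReal.rpow_neg_one]

lemma two_mul_rpow_le (hp : 1 < p) (X : ℝ≥0∞) : (2 * X) ^ (1 / p) ≤ 2 * X ^ (1 / p) := by
  have hp0 := zero_lt_one.trans hp
  rw [ENNReal.mul_rpow_of_nonneg _ _ (by positivity)]
  refine mul_le_mul_left ?_ _
  simpa using ENNReal.rpow_le_rpow_of_exponent_le (x := 2) one_le_two ((div_le_one hp0).2 hp.le)

theorem Kp_add_le (hp : 1 < p) (g h : α →ₘ[μ] ℝ) {t : ℝ} (ht : 0 < t) :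
    Kp p (g + h) t ≤ 2 * (weakLpENorm p g + ENNReal.ofReal t * strongLpENorm p h) := by
  have hp0 := zero_lt_one.trans hp
  have ht0 : ENNReal.ofReal t ≠ 0 := (ENNReal.ofReal_pos.2 ht).ne'
  unfold Kp
  rw [ENNReal.mul_iSup]
  refine iSup_le fun E => ?_
  rw [ENNReal.mul_iSup]
  refine iSup_le fun ⟨hE, hE1, hEa⟩ => ?_
  have hG : (∫⁻ s in E, rearr g (s / 2) ^ p) ^ (1 / p) ≤
      2 * weakLpENorm p g * (ENNReal.ofReal t)⁻¹ := by
    rw [setLIntegral_eq_setLIntegral_nu (F := fun s => rearr g (s / 2))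
      ((measurable_rearr g).comp (measurable_id.div_const 2)) hp0 hE hE1]
    calc _ ≤ (∫⁻ _ in E, (2 * weakLpENorm p g) ^ p ∂nu) ^ (1 / p) := by
          refine ENNReal.rpow_le_rpow (setLIntegral_mono' hE fun s hs => ?_) (by positivity)
          exact ENNReal.rpow_le_rpow (rpow_mul_rearr_half_le hp g (hE1 hs).1) hp0.le
      _ = _ := by
          rw [setLIntegral_const, ENNReal.mul_rpow_of_nonneg _ _ (by positivity), hEa,
            ofReal_rpow_neg_rpow hp0 ht, one_div, ENNReal.rpow_rpow_inv hp0.ne']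
  have hH : (∫⁻ s in E, rearr h (s / 2) ^ p) ^ (1 / p) ≤ 2 * strongLpENorm p h := by
    have e : strongLpENorm p h = (∫⁻ x, ‖h x‖ₑ ^ p ∂μ) ^ (1 / p) := by
      unfold strongLpENorm
      rw [eLpNorm_eq_lintegral_rpow_enorm_toReal (ENNReal.ofReal_pos.2 hp0).ne'
        ENNReal.ofReal_ne_top, ENNReal.toReal_ofReal hp0.le]
    rw [e]
    exact (ENNReal.rpow_le_rpow (lintegral_rearr_half_le hp0 h hE hE1) (by positivity)).trans
      (two_mul_rpow_le hp _)
  have hsum : (∫⁻ s in E, rearr (g + h) s ^ p) ^ (1 / p) ≤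
      2 * weakLpENorm p g * (ENNReal.ofReal t)⁻¹ + 2 * strongLpENorm p h := by
    refine le_trans ?_ ((ENNReal.lintegral_Lp_add_le
      ((measurable_rearr g).comp (measurable_id.div_const 2)).aemeasurable
      ((measurable_rearr h).comp (measurable_id.div_const 2)).aemeasurable hp.le).trans
      (add_le_add hG hH))
    refine ENNReal.rpow_le_rpow (setLIntegral_mono' hE fun s hs => ?_) (by positivity)
    exact ENNReal.rpow_le_rpow (rearr_add_le g h (hE1 hs).1) hp0.le
  calc ENNReal.ofReal t * (∫⁻ s in E, rearr (g + h) s ^ p) ^ (1 / p)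
      ≤ ENNReal.ofReal t *
        (2 * weakLpENorm p g * (ENNReal.ofReal t)⁻¹ + 2 * strongLpENorm p h) :=
        mul_le_mul_right hsum _
    _ = (ENNReal.ofReal t * (ENNReal.ofReal t)⁻¹) * (2 * weakLpENorm p g) +
        2 * (ENNReal.ofReal t * strongLpENorm p h) := by ring
    _ = _ := by rw [ENNReal.mul_inv_cancel ht0 ENNReal.ofReal_ne_top]; ring

end Lower

/-! ### Breaking ties and the upper bound -/

section Upper

variable {α : Type*} [MeasurableSpace α] {μ : Measure α} {p : ℝ}

/-- If some function `ξ` has null level sets, then every measurable function has, up to a bounded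
factor, a majorant whose positive level sets are null: round `|w|` to powers of `e` and let the
fractional part of `ξ` break the ties. -/
lemma exists_majorant_null_level {ξ : α → ℝ} (hξ : Measurable ξ)
    (hnull : ∀ c, μ {x | ξ x = c} = 0) {w : α → ℝ} (hw : Measurable w) :
    ∃ u : α → ℝ≥0∞, Measurable u ∧ (∀ l, l ≠ 0 → μ {x | u x = l} = 0) ∧
      ∀ x, ‖w x‖ₑ ≤ u x ∧ u x ≤ 8 * ‖w x‖ₑ := by
  classical
  set v : α → ℝ := fun x => (⌊Real.log |w x|⌋ : ℝ) + 1 + Int.fract (ξ x) with hv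
  have hvm : Measurable v := by
    refine Measurable.add (Measurable.add ?_ measurable_const) (measurable_fract.comp hξ)
    exact (measurable_from_top (f := fun k : ℤ => (k : ℝ))).comp
      (Int.measurable_floor.comp (Real.measurable_log.comp (by simpa using hw.norm)))
  refine ⟨fun x => if w x = 0 then 0 else ENNReal.ofReal (Real.exp (v x)), ?_, ?_, ?_⟩
  · exact Measurable.ite (hw (measurableSet_singleton 0)) measurable_const
      (Real.measurable_exp.comp hvm).ennreal_ofReal
  · intro l hl
    refine measure_mono_null (t := ⋃ j : ℤ, {x | ξ x = Real.log l.toReal + j}) (fun x hx => ?_)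
      (measure_iUnion_null fun j => hnull _)
    simp only [mem_ofPred_eq] at hx
    split_ifs at hx with h0
    · exact absurd hx.symm hl
    · refine mem_iUnion.2 ⟨⌊ξ x⌋ - ⌊Real.log |w x|⌋ - 1, ?_⟩
      simp only [mem_ofPred_eq]
      rw [← hx, ENNReal.toReal_ofReal (Real.exp_pos _).le, Real.log_exp, hv]
      have := Int.floor_add_fract (ξ x)
      push_cast
      linarith
  · intro x
    by_cases h0 : w x = 0
    · simp [h0]
    simp only [h0, if_false]
    have hpos : 0 < |w x| := abs_pos.2 h0
    have hlo := Int.floor_le (Real.log |w x|)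
    have hlt := Int.lt_floor_add_one (Real.log |w x|)
    have hf0 := Int.fract_nonneg (ξ x)
    have hf1 := Int.fract_lt_one (ξ x)
    rw [← ofReal_norm, Real.norm_eq_abs]
    constructor
    · refine ENNReal.ofReal_le_ofReal ((Real.exp_log hpos).symm.le.trans ?_)
      exact Real.exp_le_exp.2 (by simp only [hv]; linarith)
    · rw [← ENNReal.ofReal_ofNat 8, ← ENNReal.ofReal_mul (by norm_num)]
      refine ENNReal.ofReal_le_ofReal ?_
      have h8 : Real.exp 2 ≤ 8 := by
        have h1 := Real.exp_one_lt_d9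
        have h2 : Real.exp 2 = Real.exp 1 * Real.exp 1 := by rw [← Real.exp_add]; norm_num
        have h3 := Real.exp_pos 1
        rw [h2]
        nlinarith
      calc Real.exp (v x) ≤ Real.exp (2 + Real.log |w x|) :=
            Real.exp_le_exp.2 (by simp only [hv]; linarith)
        _ = Real.exp 2 * |w x| := by rw [Real.exp_add, Real.exp_log hpos]
        _ ≤ 8 * |w x| := mul_le_mul_of_nonneg_right h8 hpos.le

lemma decRearr_le_mul {g u : α → ℝ≥0∞} {κ : ℝ≥0∞} (hκ0 : κ ≠ 0) (hκ : κ ≠ ⊤)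
    (h : ∀ x, u x ≤ κ * g x) (s : ℝ) : decRearr μ u s ≤ κ * decRearr μ g s := by
  refine le_of_forall_lt fun l hl => ?_
  have e : ∀ y : ℝ≥0∞, l < κ * y ↔ l / κ < y := fun y => by
    rw [ENNReal.div_lt_iff (Or.inl hκ0) (Or.inl hκ), mul_comm]
  rw [e, lt_decRearr_iff]
  refine ((lt_decRearr_iff _ _ _).1 hl).trans_le (measure_mono fun x hx => ?_)
  exact (e _).1 (lt_of_lt_of_le hx (h x))

/-- A function on a probability space and its rearrangement on `(0, 1)` have the same law. -/
lemma map_decRearr [IsProbabilityMeasure μ] {u : α → ℝ≥0∞} (hu : Measurable u) :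
    (volume.restrict (Ioo (0 : ℝ) 1)).map (decRearr μ u) = μ.map u := by
  have hU := measurable_decRearr (μ := μ) u
  have : IsProbabilityMeasure (volume.restrict (Ioo (0 : ℝ) 1)) := ⟨by simp⟩
  have := Measure.isProbabilityMeasure_map (μ := μ) hu.aemeasurable
  have := Measure.isProbabilityMeasure_map (μ := volume.restrict (Ioo (0 : ℝ) 1)) hU.aemeasurable
  refine Measure.ext_of_Iic _ _ fun l => ?_
  rw [← compl_Ioi, prob_compl_eq_one_sub measurableSet_Ioi, prob_compl_eq_one_sub measurableSet_Ioi,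
    Measure.map_apply hU measurableSet_Ioi, Measure.map_apply hu measurableSet_Ioi]
  have h1 := volume_lt_decRearr (μ := μ) u 1 l
  rw [ENNReal.ofReal_one, min_eq_right prob_le_one] at h1
  exact congrArg (1 - ·) h1

/-- The splitting realizing the upper bound: with `u` as in `exists_majorant_null_level`, the rank
`μ {u > u x}` of a point `x` plays the part of the variable of the rearrangement, and `f` is cut
according to whether the rank lies in `{ψ > L}`. -/
lemma exists_decomposition [IsProbabilityMeasure μ] {ξ : α → ℝ} (hξ : Measurable ξ)
    (hnull : ∀ c, μ {x | ξ x = c} = 0) (hp : 0 < p) (f : α →ₘ[μ] ℝ) (L : ℝ≥0∞) :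
    ∃ g h : α →ₘ[μ] ℝ, f = g + h ∧ weakLpENorm p g ≤ 8 * L ∧
      strongLpENorm p h ≤ 8 * (∫⁻ s in {s | L < psi p f s} ∩ Icc 0 1, rearr f s ^ p) ^ (1 / p) := by
  obtain ⟨u, hu, hunull, hfu⟩ := exists_majorant_null_level hξ hnull f.measurable
  set A : Set ℝ := {s | L < psi p f s} ∩ Icc 0 1 with hA
  have hAm : MeasurableSet A :=
    (measurableSet_lt measurable_const (measurable_psi f)).inter measurableSet_Icc
  set R : ℝ≥0∞ → ℝ≥0∞ := fun l => μ {x | l < u x} with hR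
  have hRm : Measurable R :=
    Antitone.measurable fun l m hlm => measure_mono fun x hx => lt_of_le_of_lt hlm hx
  set Q : Set ℝ≥0∞ := {l | (R l).toReal ∈ A} with hQ
  have hQm : MeasurableSet Q := hRm.ennreal_toReal hAm
  set U := decRearr μ u with hUdef
  have hU : Measurable U := measurable_decRearr u
  have hUF : ∀ s, U s ≤ 8 * rearr f s :=
    decRearr_le_mul (by norm_num) (by norm_num) fun x => (hfu x).2
  have hUQ : ∀ s, 0 < s → 0 < U s → (U s ∈ Q ↔ s ∈ A) := fun s hs hUs => by
    -- The rank function inverts the rearrangement wherever the latter is positive.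
    have : R (U s) = ENNReal.ofReal s :=
      measure_decRearr_lt hu hunull ((lt_decRearr_iff u s 0).1 hUs)
    simp only [hQ, mem_ofPred_eq, this, ENNReal.toReal_ofReal hs.le]
  have hHm : MeasurableSet (u ⁻¹' Q) := hu hQm
  have hg := (f.measurable.indicator hHm.compl).aestronglyMeasurable (μ := μ)
  have hh := (f.measurable.indicator hHm).aestronglyMeasurable (μ := μ)
  refine ⟨AEEqFun.mk _ hg, AEEqFun.mk _ hh, ?_, ?_, ?_⟩
  · rw [AEEqFun.mk_add_mk]
    conv_lhs => rw [← AEEqFun.mk_coeFn f]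
    congr 1
    exact (indicator_compl_add_self _ _).symm
  · refine iSup₂_le fun s hs => ?_
    have hs0 : (0 : ℝ) < s := hs
    have hr : rearr (AEEqFun.mk _ hg) s =
        decRearr μ (fun x => ‖(u ⁻¹' Q)ᶜ.indicator f x‖ₑ) s := by
      refine decRearr_congr_ae ?_ s
      filter_upwards [AEEqFun.coeFn_mk _ hg] with x hx
      rw [hx]
    refine ENNReal.mul_le_of_forall_lt fun b hb l hl => (mul_le_mul_left hb.le l).trans ?_
    rw [hr, lt_decRearr_iff] at hl
    have h1 : μ {x | l < ‖(u ⁻¹' Q)ᶜ.indicator f x‖ₑ} ≤ μ (u ⁻¹' (Ioi l ∩ Qᶜ)) := by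
      refine measure_mono fun x hx => ?_
      have hx' : l < ‖(u ⁻¹' Q)ᶜ.indicator f x‖ₑ := hx
      by_cases hxQ : x ∈ u ⁻¹' Q
      · simp [indicator, hxQ] at hx'
      · rw [indicator_of_mem hxQ] at hx'
        exact ⟨hx'.trans_le (hfu x).1, hxQ⟩
    have hm : MeasurableSet (Ioi l ∩ Qᶜ) := measurableSet_Ioi.inter hQm.compl
    rw [← Measure.map_apply hu hm, ← map_decRearr hu, Measure.map_apply hU hm,
      Measure.restrict_apply (hU hm)] at h1
    -- The set has measure greater than `s`, so it is not contained in `(0, s)`.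
    obtain ⟨r, ⟨⟨hr1, hr2⟩, hr3⟩, hsr⟩ : ∃ r ∈ U ⁻¹' (Ioi l ∩ Qᶜ) ∩ Ioo (0 : ℝ) 1, s ≤ r := by
      by_contra! hc
      refine absurd (hl.trans_le (h1.trans (measure_mono (t := Ioo 0 s)
        fun r hr => ⟨hr.2.1, hc r hr⟩))) ?_
      simp
    have hlU : l < U r := hr1
    have hrA : r ∉ A := fun h => hr2 ((hUQ r hr3.1 (pos_of_gt hlU)).2 h)
    have hpsi : psi p f r ≤ L := not_lt.1 fun h => hrA ⟨h, hr3.1.le, hr3.2.le⟩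
    calc ENNReal.ofReal (s ^ (1 / p)) * l ≤ ENNReal.ofReal (r ^ (1 / p)) * (8 * rearr f r) :=
          mul_le_mul' (ENNReal.ofReal_le_ofReal (Real.rpow_le_rpow hs0.le hsr (by positivity)))
            (hlU.le.trans (hUF r))
      _ = 8 * psi p f r := by unfold psi; ring
      _ ≤ 8 * L := mul_le_mul_right hpsi 8
  · have e : strongLpENorm p (AEEqFun.mk _ hh) =
        (∫⁻ x, ‖(u ⁻¹' Q).indicator f x‖ₑ ^ p ∂μ) ^ (1 / p) := by
      unfold strongLpENorm
      rw [eLpNorm_congr_ae (AEEqFun.coeFn_mk _ hh),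
        eLpNorm_eq_lintegral_rpow_enorm_toReal (ENNReal.ofReal_pos.2 hp).ne'
        ENNReal.ofReal_ne_top, ENNReal.toReal_ofReal hp.le]
    have hφ : Measurable fun l : ℝ≥0∞ => Q.indicator (fun l => l ^ p) l :=
      (measurable_id.pow_const p).indicator hQm
    have main : ∫⁻ x, ‖(u ⁻¹' Q).indicator f x‖ₑ ^ p ∂μ ≤ 8 ^ p * ∫⁻ s in A, rearr f s ^ p := by
      calc ∫⁻ x, ‖(u ⁻¹' Q).indicator f x‖ₑ ^ p ∂μ
          ≤ ∫⁻ x, Q.indicator (fun l => l ^ p) (u x) ∂μ := by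
            refine lintegral_mono fun x => ?_
            by_cases hxQ : u x ∈ Q
            · rw [indicator_of_mem hxQ, indicator_of_mem (show x ∈ u ⁻¹' Q from hxQ)]
              exact ENNReal.rpow_le_rpow (hfu x).1 hp.le
            · rw [indicator_of_notMem (show x ∉ u ⁻¹' Q from hxQ)]
              simp [hp]
        _ = ∫⁻ s in Ioo (0 : ℝ) 1, Q.indicator (fun l => l ^ p) (U s) := by
            rw [← lintegral_map hφ hu, ← map_decRearr hu, lintegral_map hφ hU]
        _ ≤ ∫⁻ s in Ioo (0 : ℝ) 1, A.indicator (fun s => (8 * rearr f s) ^ p) s := by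
            refine setLIntegral_mono' measurableSet_Ioo fun s hs => ?_
            rcases eq_zero_or_pos (U s) with h0 | h0
            · simp [h0, indicator, hp]
            · by_cases hsA : s ∈ A
              · rw [indicator_of_mem hsA, indicator_of_mem ((hUQ s hs.1 h0).2 hsA)]
                exact ENNReal.rpow_le_rpow (hUF s) hp.le
              · rw [indicator_of_notMem fun h => hsA ((hUQ s hs.1 h0).1 h)]
                exact zero_le
        _ ≤ ∫⁻ s, A.indicator (fun s => (8 * rearr f s) ^ p) s := setLIntegral_le_lintegral _ _
        _ = 8 ^ p * ∫⁻ s in A, rearr f s ^ p := by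
            rw [lintegral_indicator hAm]
            simp only [ENNReal.mul_rpow_of_nonneg _ _ hp.le]
            rw [lintegral_const_mul _ ((measurable_rearr f).pow_const p)]
    rw [e]
    refine (ENNReal.rpow_le_rpow main (by positivity)).trans_eq ?_
    rw [ENNReal.mul_rpow_of_nonneg _ _ (by positivity), one_div, ENNReal.rpow_rpow_inv hp.ne']

theorem KFunctional_le [IsProbabilityMeasure μ] {ξ : α → ℝ} (hξ : Measurable ξ)
    (hnull : ∀ c, μ {x | ξ x = c} = 0) (hp : 0 < p) (f : α →ₘ[μ] ℝ) {t : ℝ} (ht : 0 < t)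
    (hfin : Kp p f t ≠ ⊤) :
    KFunctional (weakLpENorm p) (strongLpENorm p) f t ≤ 16 * Kp p f t := by
  have ht0 : ENNReal.ofReal t ≠ 0 := (ENNReal.ofReal_pos.2 ht).ne'
  rw [Kp_eq hp f ht] at hfin ⊢
  set a := t ^ (-p) with ha
  set J := ∫⁻ x in Ioo 0 a, decRearr nu (psi p f) x ^ p with hJ
  set L := decRearr nu (psi p f) a with hL
  have hJfin : J ^ (1 / p) ≠ ⊤ := fun h => hfin (by rw [h, ENNReal.mul_top ht0])
  -- The rearrangement of `ψ` is at least `L` on `(0, a)`, hence `L ^ p * a ≤ J`.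
  have hLJ : L ≤ ENNReal.ofReal t * J ^ (1 / p) := by
    have h1 : L ^ p * ENNReal.ofReal a ≤ J := by
      have : ENNReal.ofReal a = volume (Ioo 0 a) := by simp
      rw [this, ← setLIntegral_const]
      exact setLIntegral_mono' measurableSet_Ioo fun x hx =>
        ENNReal.rpow_le_rpow (decRearr_antitone _ hx.2.le) hp.le
    have h2 := ENNReal.rpow_le_rpow h1 (show 0 ≤ 1 / p by positivity)
    rw [ENNReal.mul_rpow_of_nonneg _ _ (by positivity), ha, ofReal_rpow_neg_rpow hp ht, one_div,
      ENNReal.rpow_rpow_inv hp.ne', ← div_eq_mul_inv,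
      ENNReal.div_le_iff ht0 ENNReal.ofReal_ne_top, mul_comm] at h2
    rwa [one_div]
  obtain ⟨g, h, hfgh, hg, hh⟩ := exists_decomposition hξ hnull hp f L
  have hm : MeasurableSet {s | L < psi p f s} :=
    measurableSet_lt measurable_const (measurable_psi f)
  have hA : (∫⁻ s in {s | L < psi p f s} ∩ Icc 0 1, rearr f s ^ p) ^ (1 / p) ≤ J ^ (1 / p) := by
    rw [setLIntegral_rearr_eq hp f (hm.inter measurableSet_Icc) inter_subset_right]
    refine ENNReal.rpow_le_rpow
      (setLIntegral_le_lintegral_decRearr (measurable_psi f) hp ?_) (by positivity)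
    rw [nu_inter_Icc hm]
    exact not_lt.1 fun h => lt_irrefl _ ((lt_decRearr_iff _ a L).2 h)
  have hg' := hg.trans (mul_le_mul_right hLJ 8)
  have hh' := hh.trans (mul_le_mul_right hA 8)
  have e8 : (8 : ℝ≥0∞) ≠ ⊤ := by norm_num
  refine (iInf_le_of_le g (iInf_le_of_le h (iInf_le _ ⟨hfgh,
    hg'.trans_lt (ENNReal.mul_lt_top e8.lt_top hfin.lt_top),
    hh'.trans_lt (ENNReal.mul_lt_top e8.lt_top hJfin.lt_top)⟩))).trans ?_
  calc weakLpENorm p g + ENNReal.ofReal t * strongLpENorm p h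
      ≤ 8 * (ENNReal.ofReal t * J ^ (1 / p)) + ENNReal.ofReal t * (8 * J ^ (1 / p)) :=
        add_le_add hg' (mul_le_mul_right hh' _)
    _ = 16 * (ENNReal.ofReal t * J ^ (1 / p)) := by ring

end Upper

lemma volume_coord_eq {n : ℕ} (i : Fin n) (c : ℝ) :
    volume {x : EuclideanSpace ℝ (Fin n) | x i = c} = 0 := by
  have h := (PiLp.volume_preserving_ofLp (Fin n)).measure_preimage
    (s := {y : Fin n → ℝ | y i = c})
    (measurableSet_eq_fun (measurable_pi_apply i) measurable_const).nullMeasurableSet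
  refine h.trans ?_
  rw [volume_pi]
  exact Measure.pi_hyperplane (α := fun _ : Fin n => ℝ) (fun _ => volume) i c

theorem theorem3p7 (p : ℝ) (hp : 1 < p) :
    ∃ c C : ℝ≥0, 0 < c ∧ 0 < C ∧
      ∀ (n : ℕ) (_ : 1 ≤ n) (Ω : Set (EuclideanSpace ℝ (Fin n))) (_ : IsOpen Ω)
        (_ : volume Ω = 1) (f : EuclideanSpace ℝ (Fin n) →ₘ[volume.restrict Ω] ℝ)
        (_ : ∃ g h : EuclideanSpace ℝ (Fin n) →ₘ[volume.restrict Ω] ℝ,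
          f = g + h ∧ weakLpENorm p g < ∞ ∧ strongLpENorm p h < ∞)
        (t : ℝ) (_ : 0 < t),
        c * Kp p f t ≤ KFunctional (weakLpENorm p) (strongLpENorm p) f t ∧
        KFunctional (weakLpENorm p) (strongLpENorm p) f t ≤ C * Kp p f t ∧
        Kp p f t = ENNReal.ofReal t *
          (∫⁻ x in Ioo 0 (t ^ (-p)), decRearr nu (psi p f) x ^ p) ^ (1 / p) := by
  have hp0 := zero_lt_one.trans hp
  refine ⟨2⁻¹, 16, by norm_num, by norm_num, fun n hn Ω _ hΩ1 f hf t ht => ⟨?_, ?_, ?_⟩⟩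
  · refine le_iInf₂ fun g h => le_iInf fun hgh => ?_
    rw [ENNReal.coe_inv two_ne_zero, ENNReal.coe_ofNat, mul_comm, ← div_eq_mul_inv]
    refine ENNReal.div_le_of_le_mul ?_
    rw [hgh.1, mul_comm]
    exact Kp_add_le hp g h ht
  · obtain ⟨g, h, rfl, hg, hh⟩ := hf
    have : IsProbabilityMeasure (volume.restrict Ω) := ⟨by simpa using hΩ1⟩
    refine KFunctional_le (ξ := fun x => x ⟨0, hn⟩) (by fun_prop) (fun c => ?_) hp0 _ ht ?_
    · exact le_antisymm ((Measure.restrict_apply_le _ _).trans (volume_coord_eq _ c).le) zero_le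
    · refine ne_top_of_le_ne_top ?_ (Kp_add_le hp g h ht)
      exact ENNReal.mul_ne_top (by norm_num) (ENNReal.add_ne_top.2
        ⟨hg.ne, ENNReal.mul_ne_top ENNReal.ofReal_ne_top hh.ne⟩)
  · exact Kp_eq hp0 f ht
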